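/- All graphs are finite and simple. Two distinct vertices of a graph $G$ are \emph{twins} if they have the same open neighborhood. A \emph{minimum twin cover} of $G$ is a set of vertices of minimum size that contains at least one vertex of every pair of twins. $\widetilde G$ denotes the quotient graph whose vertices are the classes of vertices with equal open neighborhood, two classes being adjacent if and only if they contain adjacent representatives. A set $S\subseteq V(G)$ is \emph{determining} if the identity is the only automorphism of $G$ that fixes every element of $S$, and $\det(G)$ is the minimum size of a determining set. For $t\ge 1$ and $V(G)=\{v_1,\dots,v_n\}$, the generalized Mycielskian $\mu^{(t)}(G)$ has vertices $u_i^s$ ($1\le i\le n$, $0\le s\le t$) and $w$, and its edges are $u_i^0u_j^0$, $u_i^su_j^{s+1}$ and $u_j^su_i^{s+1}$ ($0\le s<t$) for every edge $v_iv_j$ of $G$, together with $u_i^tw$ for all $i$. \textbf{Theorem.} Let $t\ge 1$. (a) Let $G$ be a graph with no isolated vertices that has at least one pair of twins, and let $T$ be a minimum twin cover of $G$. Then \[(t+1)|T|\ \le\ \det(\mu^{(t)}(G))\ \le\ (t+1)|T|+\det(\widetilde G).\] (b) Both bounds are sharp, with $\det(\widetilde G)=1$ in each of the following families of graphs satisfying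 the hypotheses of (a). The lower bound is attained by every complete bipartite graph $K_{\ell,m}$ with $\ell\ge 1$, $m\ge 2$: it has a minimum twin cover $T$ with $|T|=\ell+m-2$, and $\det(\mu^{(t)}(K_{\ell,m}))=(t+1)|T|$. The upper bound is attained, for every $n\ge 2$, by the graph with vertices $u,v,w,z,x_1,\dots,x_n$ and edges $uv$, $wz$, $vx_i$, $wx_i$ ($1\le i\le n$), which for $n=2$ is a $4$-cycle with pendant vertices at two opposite vertices: it has a minimum twin cover $T$ with $|T|=n-1$, and $\det(\mu^{(t)}(G))=(t+1)|T|+\det(\widetilde G)$. -/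

import Mathlib

namespace SimpleGraph

/-- `S` is a determining set of `G`: only the trivial automorphism fixes `S` pointwise. -/
def IsDetermining {V : Type*} (G : SimpleGraph V) (S : Finset V) : Prop :=
  ∀ φ : G ≃g G, (∀ x ∈ S, φ x = x) → φ = Iso.refl

/-- The determining number: the least size of a determining set (for a finite graph the whole
vertex set is determining, so the minimum exists). -/
noncomputable def detNumber {V : Type*} (G : SimpleGraph V) : ℕ :=
  sInf {k : ℕ | ∃ S : Finset V, G.IsDetermining S ∧ S.card = k}

/-- The relation of having the same open neighborhood. -/
def twinSetoid {V : Type*} (G : SimpleGraph V) : Setoid V where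
  r x y := G.neighborSet x = G.neighborSet y
  iseqv := ⟨fun _ => rfl, fun h => h.symm, fun h₁ h₂ => h₁.trans h₂⟩

/-- Two distinct vertices are twins if they have the same open neighborhood. -/
def IsTwin {V : Type*} (G : SimpleGraph V) (x y : V) : Prop :=
  x ≠ y ∧ G.neighborSet x = G.neighborSet y

/-- `T` contains at least one vertex of every pair of twins. -/
def IsTwinCover {V : Type*} (G : SimpleGraph V) (T : Finset V) : Prop :=
  ∀ x y : V, G.IsTwin x y → x ∈ T ∨ y ∈ T

/-- A twin cover of minimum size. -/
def IsMinTwinCover {V : Type*} (G : SimpleGraph V) (T : Finset V) : Prop :=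
  G.IsTwinCover T ∧ ∀ T' : Finset V, G.IsTwinCover T' → T.card ≤ T'.card

/-- The quotient graph `G̃` on the classes of vertices with the same open neighborhood; two
classes are adjacent iff they have adjacent representatives. -/
def twinQuotient {V : Type*} (G : SimpleGraph V) : SimpleGraph (Quotient G.twinSetoid) where
  Adj a b := ∃ p q : V, Quotient.mk _ p = a ∧ Quotient.mk _ q = b ∧ G.Adj p q
  symm := ⟨fun _ _ ⟨p, q, hp, hq, h⟩ => ⟨q, p, hq, hp, h.symm⟩⟩
  loopless := ⟨by
    rintro a ⟨p, q, hp, hq, h⟩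
    have hpq : G.neighborSet p = G.neighborSet q := Quotient.exact (hp.trans hq.symm)
    have hq' : q ∈ G.neighborSet q := hpq ▸ h
    exact G.irrefl hq'⟩

/-- Adjacency of the generalized Mycielskian: `some (s, x)` is the copy of `x` at level `s`
(level `0` carries the original vertices), `none` is the shadow master. -/
def genMycielskianAdj {V : Type*} (G : SimpleGraph V) (t : ℕ) :
    Option (Fin (t + 1) × V) → Option (Fin (t + 1) × V) → Prop
  | some (s, x), some (r, y) =>
      G.Adj x y ∧ (((s : ℕ) = 0 ∧ (r : ℕ) = 0) ∨ (r : ℕ) = s + 1 ∨ (s : ℕ) = r + 1)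
  | some (s, _), none => (s : ℕ) = t
  | none, some (r, _) => (r : ℕ) = t
  | none, none => False

/-- The generalized Mycielskian `μ^(t)(G)` with `t` levels of shadow vertices. -/
def genMycielskian {V : Type*} (G : SimpleGraph V) (t : ℕ) :
    SimpleGraph (Option (Fin (t + 1) × V)) where
  Adj := G.genMycielskianAdj t
  symm := ⟨by
    rintro (_ | ⟨s, x⟩) (_ | ⟨r, y⟩) h
    · exact h
    · exact h
    · exact h
    · exact ⟨h.1.symm, by have := h.2; omega⟩⟩
  loopless := ⟨by
    rintro (_ | ⟨s, x⟩) h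
    · exact h
    · exact G.irrefl h.1⟩

/-- The 4-cycle with two pendant vertices, with the middle vertex multiplied: vertices
`u, v, w, z` (`Sum.inl 0, 1, 2, 3`) and `x_1, …, x_n` (`Sum.inr i`), with the edges
`uv`, `wz` and `v x_i`, `w x_i` for all `i`. -/
def pendantC4 (n : ℕ) : SimpleGraph (Fin 4 ⊕ Fin n) :=
  fromRel fun a b => match a, b with
    | Sum.inl a, Sum.inl b => (a = 0 ∧ b = 1) ∨ (a = 2 ∧ b = 3)
    | Sum.inl a, Sum.inr _ => a = 1 ∨ a = 2
    | _, _ => False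

end SimpleGraph

/-! Lower bound: swapping two twins is an automorphism, so a determining set is a twin cover
(`IsDetermining.isTwinCover`). Copies of twins at one level are again twins, so a determining set of
the Mycielskian meets each of the `t + 1` disjoint levels in a copy of a twin cover of `G`.

Upper bound: take all copies of `T`, plus level-`0` copies of representatives of a determining set
of the quotient. An automorphism fixing these fixes the shadow master (`apply_none_eq_none`), hence
preserves levels (`mycielskianLevel_apply`), and acts on every level as one automorphism `g` of `G`
up to twins (`exists_iso_of_apply_none`). The representatives force `g` to preserve twin classes,
and the copies of `T` rule out permutations inside a class.

Sharpness: in `K_{l,m}` one fixed vertex of `T` already pins both sides, so no representatives are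
needed. In the pendant family the reflection fixes every `x_i`, the only vertices with twins, so a
determining set needs one vertex beyond the twin covers. -/

namespace SimpleGraph

/-! ### Determining numbers. -/

section Determining

variable {V W : Type*} {G : SimpleGraph V} {H : SimpleGraph W}

theorem IsDetermining.detNumber_le {S : Finset V} (hS : G.IsDetermining S) :
    G.detNumber ≤ S.card :=
  Nat.sInf_le ⟨S, hS, rfl⟩

theorem exists_isDetermining_card_eq_detNumber [Finite V] (G : SimpleGraph V) :
    ∃ S : Finset V, G.IsDetermining S ∧ S.card = G.detNumber := by
  have := Fintype.ofFinite V
  refine Nat.sInf_mem (s := {k : ℕ | ∃ S : Finset V, G.IsDetermining S ∧ S.card = k})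
    ⟨_, Finset.univ, fun φ hφ => ?_, rfl⟩
  ext x
  exact hφ x (Finset.mem_univ x)

theorem le_detNumber [Finite V] {k : ℕ} (h : ∀ S : Finset V, G.IsDetermining S → k ≤ S.card) :
    k ≤ G.detNumber := by
  obtain ⟨S, hS, hc⟩ := G.exists_isDetermining_card_eq_detNumber
  exact hc ▸ h S hS

theorem detNumber_le_of_iso [Finite W] (e : G ≃g H) : G.detNumber ≤ H.detNumber := by
  obtain ⟨S, hS, hc⟩ := H.exists_isDetermining_card_eq_detNumber
  rw [← hc, ← Finset.card_map (s := S) e.symm.toEquiv.toEmbedding]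
  refine IsDetermining.detNumber_le fun φ hφ => ?_
  have h := hS ((e.symm.trans φ).trans e) fun x hx => by
    have := hφ (e.symm x) (Finset.mem_map_of_mem e.symm.toEquiv.toEmbedding hx)
    simp [this]
  ext x
  have := congrArg (fun ψ : H ≃g H => e.symm (ψ (e x))) h
  simpa using this

theorem Iso.detNumber_eq [Finite V] [Finite W] (e : G ≃g H) : G.detNumber = H.detNumber :=
  le_antisymm (detNumber_le_of_iso e) (detNumber_le_of_iso e.symm)

/-- A graph with a nontrivial automorphism and a determining vertex has determining number one. -/
theorem detNumber_eq_one [Finite V] {x : V} (hx : G.IsDetermining {x}) {φ : G ≃g G}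
    (hφ : φ ≠ Iso.refl) : G.detNumber = 1 := by
  refine le_antisymm (by simpa using hx.detNumber_le) (le_detNumber fun S hS => ?_)
  rw [Nat.one_le_iff_ne_zero, Finset.card_ne_zero]
  by_contra hne
  rw [Finset.not_nonempty_iff_eq_empty] at hne
  subst hne
  exact hφ (hS φ (by simp))

end Determining

/-! ### Twins, twin covers and the twin quotient. -/

section Twins

variable {V W : Type*} {G : SimpleGraph V} {H : SimpleGraph W} {x y : V}

theorem adj_congr_of_neighborSet_eq (h : G.neighborSet x = G.neighborSet y) (z : V) :
    G.Adj x z ↔ G.Adj y z := by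
  rw [← mem_neighborSet, h, mem_neighborSet]

/-- The automorphism that interchanges two vertices with the same open neighborhood. -/
def twinSwap [DecidableEq V] (h : G.neighborSet x = G.neighborSet y) : G ≃g G where
  toEquiv := Equiv.swap x y
  map_rel_iff' := by
    have key : ∀ a b, G.Adj (Equiv.swap x y a) b ↔ G.Adj a b := by
      intro a b
      have := adj_congr_of_neighborSet_eq h b
      rw [Equiv.swap_apply_def]
      split_ifs with h₁ h₂
      · rw [h₁, this]
      · rw [h₂, this]
      · rfl
    intro a b
    rw [key, G.adj_comm, key, G.adj_comm]

/-- If both members of a twin pair were outside `S`, interchanging them would be a nontrivial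
automorphism fixing `S`. -/
theorem IsDetermining.isTwinCover {S : Finset V} (hS : G.IsDetermining S) : G.IsTwinCover S := by
  classical
  rintro x y ⟨hne, h⟩
  by_contra! hxy
  have hid := hS (twinSwap h) fun z hz =>
    Equiv.swap_apply_of_ne_of_ne (fun e => hxy.1 (e ▸ hz)) (fun e => hxy.2 (e ▸ hz))
  have : Equiv.swap x y x = x := congrArg (fun ψ : G ≃g G => ψ x) hid
  rw [Equiv.swap_apply_left] at this
  exact hne this.symm

/-- A map to `W` that separates vertices with different neighborhoods bounds the number of
vertices outside a twin cover. -/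
theorem IsTwinCover.card_le [Fintype V] [Fintype W] {T : Finset V} (hT : G.IsTwinCover T)
    (f : V → W) (hf : ∀ x y, f x = f y → G.neighborSet x = G.neighborSet y) :
    Fintype.card V ≤ T.card + Fintype.card W := by
  classical
  have : Tᶜ.card ≤ Fintype.card W := by
    refine Finset.card_le_card_of_injOn f (fun _ _ => Finset.mem_univ _) ?_
    intro x hx y hy hxy
    by_contra hne
    have := hT x y ⟨hne, hf x y hxy⟩
    simp_all
  have := T.card_add_card_compl
  omega

theorem neighborSet_eq_iff_apply_eq (f : V → W) (hf : Function.Surjective f)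
    (hadj : ∀ x y, H.Adj (f x) (f y) ↔ G.Adj x y)
    (hH : ∀ a b, H.neighborSet a = H.neighborSet b → a = b) (x y : V) :
    G.neighborSet x = G.neighborSet y ↔ f x = f y := by
  refine ⟨fun h => hH _ _ ?_, fun h => ?_⟩
  · ext b
    obtain ⟨z, rfl⟩ := hf b
    simp only [mem_neighborSet, hadj]
    exact adj_congr_of_neighborSet_eq h z
  · ext z
    simp only [mem_neighborSet, ← hadj, h]

/-- A surjective map onto a twin-free graph that preserves and reflects adjacency identifies the
target with the twin quotient. -/
theorem nonempty_twinQuotient_iso (f : V → W) (hf : Function.Surjective f)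
    (hadj : ∀ x y, H.Adj (f x) (f y) ↔ G.Adj x y)
    (hH : ∀ a b, H.neighborSet a = H.neighborSet b → a = b) :
    Nonempty (G.twinQuotient ≃g H) := by
  have hiff := neighborSet_eq_iff_apply_eq f hf hadj hH
  let g : Quotient G.twinSetoid → W := Quotient.lift f fun x y h => (hiff x y).1 h
  have hg : Function.Bijective g := by
    refine ⟨?_, fun b => ?_⟩
    · rintro ⟨x⟩ ⟨y⟩ h
      exact Quotient.sound ((hiff x y).2 h)
    · obtain ⟨z, rfl⟩ := hf b
      exact ⟨Quotient.mk _ z, rfl⟩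
  refine ⟨⟨Equiv.ofBijective g hg, ?_⟩⟩
  rintro ⟨x⟩ ⟨y⟩
  refine (hadj x y).trans ⟨fun h => ⟨x, y, rfl, rfl, h⟩, ?_⟩
  rintro ⟨p, q, hp, hq, h⟩
  have hp' : f p = f x := congrArg g hp
  have hq' : f q = f y := congrArg g hq
  rwa [← hadj, ← hp', ← hq', hadj]

theorem neighborSet_eq_iff_of_iso (f : G ≃g H) (x y : V) :
    H.neighborSet (f x) = H.neighborSet (f y) ↔ G.neighborSet x = G.neighborSet y := by
  simp only [Set.ext_iff, mem_neighborSet]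
  rw [f.surjective.forall]
  simp only [f.map_adj_iff]

theorem twinQuotient_adj_mk (x y : V) :
    G.twinQuotient.Adj (Quotient.mk _ x) (Quotient.mk _ y) ↔ G.Adj x y := by
  refine ⟨?_, fun h => ⟨x, y, rfl, rfl, h⟩⟩
  rintro ⟨p, q, hp, hq, h⟩
  have hp' : G.neighborSet p = G.neighborSet x := Quotient.exact hp
  have hq' : G.neighborSet q = G.neighborSet y := Quotient.exact hq
  rwa [← adj_congr_of_neighborSet_eq hp', G.adj_comm, ← adj_congr_of_neighborSet_eq hq', G.adj_comm]

/-- The automorphism of the twin quotient induced by an automorphism of the graph. -/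
def twinQuotientMap (f : G ≃g G) : G.twinQuotient ≃g G.twinQuotient where
  toEquiv := Quotient.congr f.toEquiv fun x y => (neighborSet_eq_iff_of_iso f x y).symm
  map_rel_iff' := by
    rintro ⟨x⟩ ⟨y⟩
    exact (twinQuotient_adj_mk (f x) (f y)).trans
      (f.map_adj_iff.trans (twinQuotient_adj_mk x y).symm)

end Twins

/-! ### The two bounds for the generalized Mycielskian. -/

section Mycielskian

variable {V : Type*} {G : SimpleGraph V} {t : ℕ}

theorem genMycielskian_adj_some {s r : Fin (t + 1)} {x y : V} :
    (G.genMycielskian t).Adj (some (s, x)) (some (r, y)) ↔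
      G.Adj x y ∧ (((s : ℕ) = 0 ∧ (r : ℕ) = 0) ∨ (r : ℕ) = s + 1 ∨ (s : ℕ) = r + 1) :=
  Iff.rfl

theorem genMycielskian_adj_none {r : Fin (t + 1)} {y : V} :
    (G.genMycielskian t).Adj none (some (r, y)) ↔ (r : ℕ) = t :=
  Iff.rfl

theorem genMycielskian_not_adj_none_none : ¬ (G.genMycielskian t).Adj none none :=
  (G.genMycielskian t).irrefl

theorem IsTwin.genMycielskian {x y : V} (h : G.IsTwin x y) (s : Fin (t + 1)) :
    (G.genMycielskian t).IsTwin (some (s, x)) (some (s, y)) := by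
  refine ⟨fun e => h.1 (by simpa using e), ?_⟩
  ext (_ | ⟨r, z⟩)
  · exact Iff.rfl
  · simp only [mem_neighborSet, genMycielskian_adj_some, adj_congr_of_neighborSet_eq h.2]

/-- The vertices of `G` whose copies at level `s` lie in `S`. -/
noncomputable def levelFiber (S : Finset (Option (Fin (t + 1) × V))) (s : Fin (t + 1)) : Finset V :=
  S.preimage (fun x => some (s, x)) fun x _ y _ h => by simpa using h

theorem mem_levelFiber {S : Finset (Option (Fin (t + 1) × V))} {s : Fin (t + 1)} {x : V} :
    x ∈ levelFiber S s ↔ some (s, x) ∈ S :=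
  Finset.mem_preimage

/-- Only an inequality, since the shadow master may lie in `S`. -/
theorem sum_card_levelFiber_le (S : Finset (Option (Fin (t + 1) × V))) :
    ∑ s, (levelFiber S s).card ≤ S.card := by
  rw [← Finset.card_sigma]
  refine Finset.card_le_card_of_injOn (fun p => some (p.1, p.2)) ?_ ?_
  · rintro ⟨s, x⟩ h
    simpa [mem_levelFiber] using h
  · rintro ⟨s, x⟩ _ ⟨r, y⟩ _ h
    simp only [Option.some.injEq, Prod.mk.injEq] at h
    obtain ⟨rfl, rfl⟩ := h
    rfl

theorem IsMinTwinCover.mul_card_le {T : Finset V} (hT : G.IsMinTwinCover T)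
    {S : Finset (Option (Fin (t + 1) × V))} (hS : ∀ s, G.IsTwinCover (levelFiber S s)) :
    (t + 1) * T.card ≤ S.card := by
  refine le_trans ?_ (sum_card_levelFiber_le S)
  simpa using Finset.card_nsmul_le_sum Finset.univ (fun s => (levelFiber S s).card) T.card
    fun s _ => hT.2 _ (hS s)

theorem IsTwinCover.levelFiber {S : Finset (Option (Fin (t + 1) × V))}
    (hS : (G.genMycielskian t).IsTwinCover S) (s : Fin (t + 1)) :
    G.IsTwinCover (levelFiber S s) := fun x y h => by
  simpa only [mem_levelFiber] using hS _ _ (h.genMycielskian s)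

/-- The level of a vertex of the generalized Mycielskian, the shadow master being on top. -/
def mycielskianLevel : Option (Fin (t + 1) × V) → ℕ
  | none => t + 1
  | some (s, _) => s

theorem mycielskianLevel_le (v : Option (Fin (t + 1) × V)) : mycielskianLevel v ≤ t + 1 := by
  rcases v with _ | ⟨s, x⟩
  · exact le_rfl
  · exact s.2.le

theorem mycielskianLevel_of_adj {v w : Option (Fin (t + 1) × V)}
    (h : (G.genMycielskian t).Adj v w) :
    (mycielskianLevel v = 0 ∧ mycielskianLevel w = 0) ∨
      mycielskianLevel w = mycielskianLevel v + 1 ∨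
      mycielskianLevel v = mycielskianLevel w + 1 := by
  rcases v with _ | ⟨s, x⟩ <;> rcases w with _ | ⟨r, y⟩
  · exact absurd h genMycielskian_not_adj_none_none
  · have : (r : ℕ) = t := h
    simp [mycielskianLevel, this]
  · have : (s : ℕ) = t := h
    simp [mycielskianLevel, this]
  · exact h.2

theorem exists_adj_mycielskianLevel_eq_succ (hG : ∀ x, ∃ y, G.Adj x y)
    {v : Option (Fin (t + 1) × V)} (hv : mycielskianLevel v < t + 1) :
    ∃ w, (G.genMycielskian t).Adj v w ∧ mycielskianLevel w = mycielskianLevel v + 1 := by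
  rcases v with _ | ⟨s, x⟩
  · exact absurd hv (lt_irrefl _)
  · by_cases hs : (s : ℕ) = t
    · exact ⟨none, hs, by simp [mycielskianLevel, hs]⟩
    · obtain ⟨y, hy⟩ := hG x
      have hlt : (s : ℕ) + 1 < t + 1 := by have := s.2; omega
      exact ⟨some (⟨s + 1, hlt⟩, y), ⟨hy, Or.inr (Or.inl rfl)⟩, rfl⟩

theorem mycielskianLevel_eq_top {v : Option (Fin (t + 1) × V)}
    (hv : mycielskianLevel v = t + 1) : v = none := by
  rcases v with _ | ⟨s, x⟩
  · rfl
  · have := s.2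
    simp only [mycielskianLevel] at hv
    omega

/-- An automorphism that fixes the shadow master preserves the levels. -/
theorem mycielskianLevel_apply (hG : ∀ x, ∃ y, G.Adj x y)
    (φ : G.genMycielskian t ≃g G.genMycielskian t) (hφ : φ none = none)
    (v : Option (Fin (t + 1) × V)) : mycielskianLevel (φ v) = mycielskianLevel v := by
  -- Strong induction on the distance `k` from the top level; `φ` is quantified inside because the
  -- hypothesis is also applied to `φ.symm`.
  suffices key : ∀ k : ℕ, ∀ φ : G.genMycielskian t ≃g G.genMycielskian t, φ none = none →
      ∀ v, mycielskianLevel v + k = t + 1 → mycielskianLevel (φ v) = mycielskianLevel v from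
    key (t + 1 - mycielskianLevel v) φ hφ v (by have := mycielskianLevel_le v; omega)
  intro k
  induction k using Nat.strong_induction_on with
  | _ k ih =>
    intro φ hφ v hv
    rcases Nat.eq_zero_or_pos k with rfl | hk
    · rw [mycielskianLevel_eq_top hv, hφ]
    · obtain ⟨w, hw, hlw⟩ := exists_adj_mycielskianLevel_eq_succ hG (v := v) (by omega)
      have h₁ := ih (k - 1) (by omega) φ hφ w (by omega)
      have h₂ := mycielskianLevel_of_adj (φ.map_adj_iff.2 hw)
      have h₃ := mycielskianLevel_le (φ v)
      by_cases h₄ : mycielskianLevel (φ v) = mycielskianLevel v + 2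
      · have h₅ := ih (k - 2) (by omega) φ.symm (by rw [← hφ, φ.symm_apply_apply, hφ]) (φ v)
          (by omega)
        rw [φ.symm_apply_apply] at h₅
        omega
      · omega

/-- An automorphism that fixes all copies of some vertex of `G` fixes the shadow master. -/
theorem apply_none_eq_none (ht : 1 ≤ t) (φ : G.genMycielskian t ≃g G.genMycielskian t) {y : V}
    (hy : ∀ s, φ (some (s, y)) = some (s, y)) : φ none = none := by
  have h₁ : (G.genMycielskian t).Adj (φ none) (some (Fin.last t, y)) := by
    rw [← hy, φ.map_adj_iff]
    exact Fin.val_last t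
  rcases hn : φ none with _ | ⟨s, z⟩
  · rfl
  · rw [hn, genMycielskian_adj_some, Fin.val_last] at h₁
    have hs := s.2
    -- Here `s = t - 1`, so `φ none` also sees the copy of `y` one level below. For `t = 1` the
    -- truncated `t - 2` is `0`, and the edge lies within level `0`. The master has no neighbor at
    -- that level.
    have h₂ : (G.genMycielskian t).Adj (φ none) (some (⟨t - 2, by omega⟩, y)) := by
      rw [hn, genMycielskian_adj_some]
      refine ⟨h₁.1, ?_⟩
      simp only
      omega
    rw [← hy, φ.map_adj_iff, genMycielskian_adj_none] at h₂
    simp only at h₂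
    omega

/-- An automorphism that fixes the shadow master acts on the levels by permutations that all
agree, up to twins, with a single automorphism of `G`. -/
theorem exists_iso_of_apply_none (hG : ∀ x, ∃ y, G.Adj x y)
    (φ : G.genMycielskian t ≃g G.genMycielskian t) (hφ : φ none = none) :
    ∃ (g : G ≃g G) (f : Fin (t + 1) → V → V),
      (∀ s x, φ (some (s, x)) = some (s, f s x)) ∧ (∀ x, f 0 x = g x) ∧
      ∀ s x, G.neighborSet (f s x) = G.neighborSet (g x) := by
  have hex : ∀ ψ : G.genMycielskian t ≃g G.genMycielskian t, ψ none = none →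
      ∀ s x, ∃ y, ψ (some (s, x)) = some (s, y) := by
    intro ψ hψ s x
    have hl := mycielskianLevel_apply hG ψ hψ (some (s, x))
    rcases hn : ψ (some (s, x)) with _ | ⟨r, z⟩
    · rw [← hψ] at hn
      exact absurd (ψ.injective hn) (by simp)
    · rw [hn] at hl
      exact ⟨z, by rw [Fin.ext hl]⟩
  have hφ' : φ.symm none = none := by rw [← hφ, φ.symm_apply_apply, hφ]
  choose f hf using hex φ hφ
  choose f' hf' using hex φ.symm hφ'
  have hleft : ∀ s x, f' s (f s x) = x := fun s x => by
    have := φ.symm_apply_apply (some (s, x))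
    rw [hf, hf'] at this
    simpa using this
  have hright : ∀ s x, f s (f' s x) = x := fun s x => by
    have := φ.apply_symm_apply (some (s, x))
    rw [hf', hf] at this
    simpa using this
  have hadj : ∀ s r : Fin (t + 1),
      (((s : ℕ) = 0 ∧ (r : ℕ) = 0) ∨ (r : ℕ) = s + 1 ∨ (s : ℕ) = r + 1) →
      ∀ x y, G.Adj (f s x) (f r y) ↔ G.Adj x y := by
    intro s r hsr x y
    have := φ.map_adj_iff (v := some (s, x)) (w := some (r, y))
    rw [hf, hf, genMycielskian_adj_some, genMycielskian_adj_some] at this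
    simpa only [hsr, and_true] using this
  let g : G ≃g G := ⟨⟨f 0, f' 0, hleft 0, hright 0⟩, fun {x y} => hadj 0 0 (by simp) x y⟩
  have hg : ∀ x, f 0 x = g x := fun _ => rfl
  refine ⟨g, f, hf, hg, ?_⟩
  -- Climbing the levels: the edges between levels `k` and `k + 1` determine the neighborhood of `f
  -- (k + 1) x` from the action at level `k`, which agrees with `g` up to twins.
  suffices key : ∀ (k : ℕ) (hk : k < t + 1) x,
      G.neighborSet (f ⟨k, hk⟩ x) = G.neighborSet (g x) from fun s x => key s s.2 x
  intro k
  induction k with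
  | zero => exact fun _ _ => rfl
  | succ k ih =>
    intro hk x
    have hk' : k < t + 1 := by omega
    ext z
    rw [← hright ⟨k, hk'⟩ z, mem_neighborSet, mem_neighborSet,
      hadj _ _ (Or.inr (Or.inr rfl)), G.adj_comm (g x),
      adj_congr_of_neighborSet_eq (ih hk' _), g.map_adj_iff, G.adj_comm]

/-- Copies of a nonempty twin cover `T` at all levels together with copies of `D` at the bottom
level are determining, provided that the automorphisms of `G` that fix `T` and `D` preserve
every twin class. -/
theorem detNumber_genMycielskian_le (ht : 1 ≤ t) (hG : ∀ x, ∃ y, G.Adj x y) {T : Finset V}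
    (hT : G.IsTwinCover T) (hne : T.Nonempty) (D : Finset V)
    (hD : ∀ g : G ≃g G, (∀ x ∈ T, G.neighborSet (g x) = G.neighborSet x) →
      (∀ x ∈ D, g x = x) → ∀ x, G.neighborSet (g x) = G.neighborSet x) :
    (G.genMycielskian t).detNumber ≤ (t + 1) * T.card + D.card := by
  classical
  let A : Finset (Option (Fin (t + 1) × V)) :=
    ((Finset.univ : Finset (Fin (t + 1))) ×ˢ T).image some
  let B : Finset (Option (Fin (t + 1) × V)) := D.image fun x => some (0, x)
  have hcard : (A ∪ B).card ≤ (t + 1) * T.card + D.card := by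
    refine (Finset.card_union_le _ _).trans (add_le_add ?_ Finset.card_image_le)
    exact Finset.card_image_le.trans (by simp)
  refine le_trans (IsDetermining.detNumber_le fun φ hφ => ?_) hcard
  have hA : ∀ s, ∀ x ∈ T, φ (some (s, x)) = some (s, x) := fun s x hx =>
    hφ _ (Finset.mem_union_left _ (by simpa [A] using hx))
  have hB : ∀ x ∈ D, φ (some (0, x)) = some (0, x) := fun x hx =>
    hφ _ (Finset.mem_union_right _ (by simpa [B] using hx))
  obtain ⟨y, hy⟩ := hne
  have hnone := apply_none_eq_none ht φ fun s => hA s y hy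
  obtain ⟨g, f, hf, hfg, htw⟩ := exists_iso_of_apply_none hG φ hnone
  have hfT : ∀ s, ∀ x ∈ T, f s x = x := fun s x hx => by
    have := hA s x hx
    rw [hf] at this
    simpa using this
  have hg := hD g (fun x hx => by rw [← hfg, hfT 0 x hx]) fun x hx => by
    have := hB x hx
    rw [hf] at this
    rw [← hfg]
    simpa using this
  have hfix : ∀ s x, f s x = x := by
    intro s x
    by_contra hne
    -- If `f s x` and `x` were distinct they would be twins, so one of them would lie in `T` and be
    -- fixed by `f s`; injectivity excludes this.
    rcases hT (f s x) x ⟨hne, (htw s x).trans (hg x)⟩ with h | h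
    · have h' : φ (some (s, f s x)) = φ (some (s, x)) := by rw [hf, hf, hfT s _ h]
      exact hne (by simpa using φ.injective h')
    · exact hne (hfT s x h)
  ext (_ | ⟨s, x⟩) : 1
  · exact hnone
  · rw [hf, hfix]
    rfl

/-- An automorphism of `G` fixing representatives of a determining set of the quotient induces the
identity there, that is, preserves every twin class. -/
theorem genMycielskian_detNumber_le_add [Finite V] (ht : 1 ≤ t) (hG : ∀ x, ∃ y, G.Adj x y)
    {T : Finset V} (hT : G.IsTwinCover T) (hne : T.Nonempty) :
    (G.genMycielskian t).detNumber ≤ (t + 1) * T.card + G.twinQuotient.detNumber := by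
  classical
  obtain ⟨S, hS, hc⟩ := G.twinQuotient.exists_isDetermining_card_eq_detNumber
  refine (detNumber_genMycielskian_le ht hG hT hne (S.image Quotient.out) ?_).trans
    (Nat.add_le_add_left (Finset.card_image_le.trans hc.le) _)
  intro g _ hg x
  have hid := hS (twinQuotientMap g) fun a ha => by
    have := hg a.out (Finset.mem_image_of_mem _ ha)
    conv_lhs => rw [← Quotient.out_eq a]
    change Quotient.mk _ (g a.out) = a
    rw [this, Quotient.out_eq]
  exact Quotient.exact
    (congrArg (fun ψ : G.twinQuotient ≃g G.twinQuotient => ψ (Quotient.mk _ x)) hid)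

/-- The automorphism of the generalized Mycielskian induced by an automorphism of `G`. -/
def genMycielskianMap (t : ℕ) (g : G ≃g G) : G.genMycielskian t ≃g G.genMycielskian t where
  toEquiv := Equiv.optionCongr ((Equiv.refl _).prodCongr g.toEquiv)
  map_rel_iff' := by
    rintro (_ | ⟨s, x⟩) (_ | ⟨r, y⟩)
    · exact Iff.rfl
    · exact Iff.rfl
    · exact Iff.rfl
    · exact and_congr_left fun _ => g.map_adj_iff

theorem mul_card_le_detNumber [Finite V] {T : Finset V} (hT : G.IsMinTwinCover T) :
    (t + 1) * T.card ≤ (G.genMycielskian t).detNumber :=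
  le_detNumber fun _ hS => hT.mul_card_le fun s => hS.isTwinCover.levelFiber s

theorem exists_adj_of_not_isIsolated (h : ∀ x, ¬ G.IsIsolated x) (x : V) : ∃ y, G.Adj x y := by
  have := h x
  simp only [IsIsolated, not_forall, not_not] at this
  exact this

end Mycielskian

/-! ### Sharpness of the lower bound. -/

section CompleteBipartite

variable {l m : ℕ}

/-- `Sum.isLeft` realizes the twin quotient as `K₂` on `Bool`; the twin classes are the two sides.
-/
theorem completeBipartiteGraph_adj_iff_ne (x y : Fin l ⊕ Fin m) :
    (⊤ : SimpleGraph Bool).Adj x.isLeft y.isLeft ↔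
      (completeBipartiteGraph (Fin l) (Fin m)).Adj x y := by
  rcases x with x | x <;> rcases y with y | y <;> simp

theorem isLeft_surjective (hl : 1 ≤ l) (hm : 1 ≤ m) :
    Function.Surjective (Sum.isLeft : Fin l ⊕ Fin m → Bool) := by
  rintro (_ | _)
  · exact ⟨Sum.inr ⟨0, hm⟩, rfl⟩
  · exact ⟨Sum.inl ⟨0, hl⟩, rfl⟩

theorem top_bool_twinFree (a b : Bool)
    (h : (⊤ : SimpleGraph Bool).neighborSet a = (⊤ : SimpleGraph Bool).neighborSet b) : a = b := by
  by_contra hne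
  have := adj_congr_of_neighborSet_eq h b
  simp [hne] at this

theorem completeBipartiteGraph_neighborSet_eq_iff (hl : 1 ≤ l) (hm : 1 ≤ m)
    (x y : Fin l ⊕ Fin m) :
    (completeBipartiteGraph (Fin l) (Fin m)).neighborSet x =
      (completeBipartiteGraph (Fin l) (Fin m)).neighborSet y ↔ x.isLeft = y.isLeft :=
  neighborSet_eq_iff_apply_eq _ (isLeft_surjective hl hm) completeBipartiteGraph_adj_iff_ne
    top_bool_twinFree x y

theorem detNumber_top_bool : (⊤ : SimpleGraph Bool).detNumber = 1 := by
  refine detNumber_eq_one (x := true) (fun φ hφ => ?_) (φ := Iso.completeGraph Equiv.boolNot) ?_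
  · have h₁ : φ true = true := hφ true (by simp)
    have h₂ : φ false ≠ φ true := φ.injective.ne (by decide)
    ext (_ | _)
    · simpa [h₁] using h₂
    · exact h₁
  · intro h
    have := congrArg (fun ψ : (⊤ : SimpleGraph Bool) ≃g ⊤ => ψ true) h
    exact absurd this (by decide)

theorem detNumber_twinQuotient_completeBipartiteGraph (hl : 1 ≤ l) (hm : 1 ≤ m) :
    (completeBipartiteGraph (Fin l) (Fin m)).twinQuotient.detNumber = 1 := by
  obtain ⟨e⟩ := nonempty_twinQuotient_iso _ (isLeft_surjective hl hm)
    completeBipartiteGraph_adj_iff_ne top_bool_twinFree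
  rw [e.detNumber_eq, detNumber_top_bool]

theorem completeBipartiteGraph_exists_adj (hl : 1 ≤ l) (hm : 1 ≤ m) (x : Fin l ⊕ Fin m) :
    ∃ y, (completeBipartiteGraph (Fin l) (Fin m)).Adj x y := by
  rcases x with x | x
  · exact ⟨Sum.inr ⟨0, hm⟩, by simp⟩
  · exact ⟨Sum.inl ⟨0, hl⟩, by simp⟩

theorem exists_isMinTwinCover_completeBipartiteGraph (hl : 1 ≤ l) (hm : 1 ≤ m) :
    ∃ T, (completeBipartiteGraph (Fin l) (Fin m)).IsMinTwinCover T ∧ T.card + 2 = l + m := by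
  let P : Finset (Fin l ⊕ Fin m) := {Sum.inl ⟨0, hl⟩, Sum.inr ⟨0, hm⟩}
  have hP : P.card = 2 := Finset.card_pair (by simp)
  have hcard := P.card_add_card_compl
  rw [hP, Fintype.card_sum, Fintype.card_fin, Fintype.card_fin] at hcard
  refine ⟨Pᶜ, ⟨?_, fun T' hT' => ?_⟩, by omega⟩
  · rintro x y ⟨hne, h⟩
    rw [completeBipartiteGraph_neighborSet_eq_iff hl hm] at h
    rw [Finset.mem_compl, Finset.mem_compl, ← not_and_or]
    rintro ⟨hx, hy⟩
    simp only [P, Finset.mem_insert, Finset.mem_singleton] at hx hy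
    rcases hx with rfl | rfl <;> rcases hy with rfl | rfl <;> simp_all
  · have := hT'.card_le Sum.isLeft
      fun x y => (completeBipartiteGraph_neighborSet_eq_iff hl hm x y).2
    rw [Fintype.card_sum, Fintype.card_fin, Fintype.card_fin, Fintype.card_bool] at this
    omega

/-- Adjacency to a vertex `y` of `T` tells the two sides apart, so an automorphism keeping `y` on
its side keeps both sides; hence `D = ∅` suffices. -/
theorem detNumber_genMycielskian_completeBipartiteGraph_le {t : ℕ} (ht : 1 ≤ t) (hl : 1 ≤ l)
    (hm : 1 ≤ m) {T : Finset (Fin l ⊕ Fin m)}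
    (hT : (completeBipartiteGraph (Fin l) (Fin m)).IsTwinCover T) (hne : T.Nonempty) :
    ((completeBipartiteGraph (Fin l) (Fin m)).genMycielskian t).detNumber ≤ (t + 1) * T.card := by
  refine detNumber_genMycielskian_le ht (completeBipartiteGraph_exists_adj hl hm) hT hne ∅ ?_
  intro g hg _ x
  obtain ⟨y, hy⟩ := hne
  have h₁ := (completeBipartiteGraph_neighborSet_eq_iff hl hm _ _).1 (hg y hy)
  have h₂ := g.map_adj_iff (v := x) (w := y)
  rw [← completeBipartiteGraph_adj_iff_ne, ← completeBipartiteGraph_adj_iff_ne, h₁, top_adj,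
    top_adj] at h₂
  rw [completeBipartiteGraph_neighborSet_eq_iff hl hm]
  clear h₁
  generalize (g x).isLeft = a at *
  generalize x.isLeft = b at *
  generalize y.isLeft = c at *
  revert a b c
  decide

end CompleteBipartite

/-! ### Sharpness of the upper bound. -/

section PendantC4

variable {n : ℕ}

theorem pendantC4_adj_inl_inl {a b : Fin 4} : (pendantC4 n).Adj (Sum.inl a) (Sum.inl b) ↔
    ((a = 0 ∧ b = 1) ∨ (a = 2 ∧ b = 3)) ∨ ((b = 0 ∧ a = 1) ∨ (b = 2 ∧ a = 3)) := by
  rw [pendantC4, fromRel_adj, and_iff_right_iff_imp]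
  rintro h e
  rw [Sum.inl.injEq] at e
  subst e
  simp only at h
  revert a
  decide

theorem pendantC4_adj_inl_inr {a : Fin 4} {i : Fin n} :
    (pendantC4 n).Adj (Sum.inl a) (Sum.inr i) ↔ a = 1 ∨ a = 2 := by
  simp [pendantC4]

theorem pendantC4_adj_inr_inl {a : Fin 4} {i : Fin n} :
    (pendantC4 n).Adj (Sum.inr i) (Sum.inl a) ↔ a = 1 ∨ a = 2 := by
  simp [pendantC4]

theorem pendantC4_not_adj_inr_inr {i j : Fin n} :
    ¬ (pendantC4 n).Adj (Sum.inr i) (Sum.inr j) := by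
  simp [pendantC4]

instance : DecidableRel (pendantC4 n).Adj
  | Sum.inl _, Sum.inl _ => decidable_of_iff' _ pendantC4_adj_inl_inl
  | Sum.inl _, Sum.inr _ => decidable_of_iff' _ pendantC4_adj_inl_inr
  | Sum.inr _, Sum.inl _ => decidable_of_iff' _ pendantC4_adj_inr_inl
  | Sum.inr _, Sum.inr _ => isFalse pendantC4_not_adj_inr_inr

/-- The map that merges the middle vertices. -/
def pendantC4Collapse (n : ℕ) : Fin 4 ⊕ Fin n → Fin 4 ⊕ Fin 1 :=
  Sum.map id fun _ => 0

theorem pendantC4Collapse_surjective (hn : 1 ≤ n) : Function.Surjective (pendantC4Collapse n) :=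
  Function.surjective_id.sumMap fun _ => ⟨⟨0, hn⟩, Subsingleton.elim _ _⟩

/-- The twin quotient is `pendantC4 1`, the path `u v x w z`. -/
theorem pendantC4Collapse_adj (x y : Fin 4 ⊕ Fin n) :
    (pendantC4 1).Adj (pendantC4Collapse n x) (pendantC4Collapse n y) ↔ (pendantC4 n).Adj x y := by
  rcases x with x | x <;> rcases y with y | y <;>
    simp [pendantC4Collapse, pendantC4_adj_inl_inl, pendantC4_adj_inl_inr, pendantC4_adj_inr_inl,
      pendantC4_not_adj_inr_inr]

theorem pendantC4_one_twinFree (a b : Fin 4 ⊕ Fin 1)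
    (h : (pendantC4 1).neighborSet a = (pendantC4 1).neighborSet b) : a = b := by
  have := adj_congr_of_neighborSet_eq h
  revert a b
  suffices ∀ a b : Fin 4 ⊕ Fin 1,
      (∀ z, (pendantC4 1).Adj a z ↔ (pendantC4 1).Adj b z) → a = b from fun a b _ => this a b
  decide

theorem pendantC4_neighborSet_eq_iff (hn : 1 ≤ n) (x y : Fin 4 ⊕ Fin n) :
    (pendantC4 n).neighborSet x = (pendantC4 n).neighborSet y ↔
      pendantC4Collapse n x = pendantC4Collapse n y :=
  neighborSet_eq_iff_apply_eq _ (pendantC4Collapse_surjective hn) pendantC4Collapse_adj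
    pendantC4_one_twinFree x y

theorem IsTwin.exists_inr (hn : 1 ≤ n) {x y : Fin 4 ⊕ Fin n} (h : (pendantC4 n).IsTwin x y) :
    ∃ i j, i ≠ j ∧ x = Sum.inr i ∧ y = Sum.inr j := by
  obtain ⟨hne, h⟩ := h
  rw [pendantC4_neighborSet_eq_iff hn] at h
  rcases x with x | x <;> rcases y with y | y <;> simp_all [pendantC4Collapse]

/-- The reflection of the graph that fixes the middle vertices. -/
def pendantC4Reflection (n : ℕ) : pendantC4 n ≃g pendantC4 n where
  toEquiv := Equiv.sumCongr Fin.revPerm (Equiv.refl _)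
  map_rel_iff' := by
    rintro (a | i) (b | j)
    · simp only [Equiv.sumCongr_apply, Sum.map_inl, pendantC4_adj_inl_inl]
      revert a b
      decide
    · simp only [Equiv.sumCongr_apply, Sum.map_inl, Sum.map_inr, pendantC4_adj_inl_inr]
      revert a
      decide
    · simp only [Equiv.sumCongr_apply, Sum.map_inl, Sum.map_inr, pendantC4_adj_inr_inl]
      revert b
      decide
    · simp [pendantC4_not_adj_inr_inr]

/-- Fixing an end of the path fixes the rest in turn: each next vertex is the only neighbor of the
last one not yet accounted for. -/
theorem detNumber_pendantC4_one : (pendantC4 1).detNumber = 1 := by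
  refine detNumber_eq_one (x := Sum.inl 0) (fun φ hφ => ?_) (φ := pendantC4Reflection 1) ?_
  · have h₀ : φ (Sum.inl 0) = Sum.inl 0 := hφ _ (by simp)
    have hadj : ∀ {x y}, (pendantC4 1).Adj x y → (pendantC4 1).Adj (φ x) (φ y) :=
      fun h => φ.map_adj_iff.2 h
    have h₁ : φ (Sum.inl 1) = Sum.inl 1 := by
      have h := hadj (x := Sum.inl 0) (y := Sum.inl 1) (by decide)
      rw [h₀] at h
      revert h
      generalize φ (Sum.inl 1) = a
      revert a
      decide
    have hx : φ (Sum.inr 0) = Sum.inr 0 := by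
      have h := hadj (x := Sum.inl 1) (y := Sum.inr 0) (by decide)
      have h' : φ (Sum.inr 0) ≠ φ (Sum.inl 0) := φ.injective.ne (by decide)
      rw [h₁] at h
      rw [h₀] at h'
      revert h h'
      generalize φ (Sum.inr 0) = a
      revert a
      decide
    have h₂ : φ (Sum.inl 2) = Sum.inl 2 := by
      have h := hadj (x := Sum.inr 0) (y := Sum.inl 2) (by decide)
      have h' : φ (Sum.inl 2) ≠ φ (Sum.inl 1) := φ.injective.ne (by decide)
      rw [hx] at h
      rw [h₁] at h'
      revert h h'
      generalize φ (Sum.inl 2) = a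
      revert a
      decide
    have h₃ : φ (Sum.inl 3) = Sum.inl 3 := by
      have h := hadj (x := Sum.inl 2) (y := Sum.inl 3) (by decide)
      have h' : φ (Sum.inl 3) ≠ φ (Sum.inr 0) := φ.injective.ne (by decide)
      rw [h₂] at h
      rw [hx] at h'
      revert h h'
      generalize φ (Sum.inl 3) = a
      revert a
      decide
    ext (a | i) : 1
    · fin_cases a
      exacts [h₀, h₁, h₂, h₃]
    · fin_cases i
      exact hx
  · intro h
    have := congrArg (fun ψ : pendantC4 1 ≃g pendantC4 1 => ψ (Sum.inl 0)) h
    exact absurd this (by decide)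

theorem detNumber_twinQuotient_pendantC4 (hn : 1 ≤ n) :
    (pendantC4 n).twinQuotient.detNumber = 1 := by
  obtain ⟨e⟩ := nonempty_twinQuotient_iso _ (pendantC4Collapse_surjective hn)
    pendantC4Collapse_adj pendantC4_one_twinFree
  rw [e.detNumber_eq, detNumber_pendantC4_one]

theorem pendantC4_exists_adj (hn : 1 ≤ n) (x : Fin 4 ⊕ Fin n) : ∃ y, (pendantC4 n).Adj x y := by
  rcases x with a | i
  · have : a = 0 ∨ (a = 1 ∨ a = 2) ∨ a = 3 := by revert a; decide
    rcases this with rfl | h | rfl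
    · exact ⟨Sum.inl 1, pendantC4_adj_inl_inl.2 (by decide)⟩
    · exact ⟨Sum.inr ⟨0, hn⟩, pendantC4_adj_inl_inr.2 h⟩
    · exact ⟨Sum.inl 2, pendantC4_adj_inl_inl.2 (by decide)⟩
  · exact ⟨Sum.inl 1, pendantC4_adj_inr_inl.2 (Or.inl rfl)⟩

theorem exists_isMinTwinCover_pendantC4 (hn : 1 ≤ n) :
    ∃ T, (pendantC4 n).IsMinTwinCover T ∧ T.card + 1 = n := by
  let T : Finset (Fin 4 ⊕ Fin n) := ({⟨0, hn⟩}ᶜ : Finset (Fin n)).map Function.Embedding.inr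
  have hcard : T.card + 1 = n := by
    rw [Finset.card_map, Finset.card_compl, Fintype.card_fin, Finset.card_singleton]
    omega
  refine ⟨T, ⟨?_, fun T' hT' => ?_⟩, hcard⟩
  · intro x y h
    obtain ⟨i, j, hij, rfl, rfl⟩ := h.exists_inr hn
    by_contra! hxy
    simp only [T, Finset.mem_map, Finset.mem_compl, Finset.mem_singleton,
      Function.Embedding.inr_apply, Sum.inr.injEq, exists_eq_right, not_not] at hxy
    exact hij (hxy.1.trans hxy.2.symm)
  · have := hT'.card_le _ fun x y => (pendantC4_neighborSet_eq_iff hn x y).2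
    rw [Fintype.card_sum, Fintype.card_sum, Fintype.card_fin, Fintype.card_fin,
      Fintype.card_fin] at this
    omega

/-- A determining set of the Mycielskian of `pendantC4 n` contains, besides twin covers at all
levels, a vertex that is moved by the reflection. -/
theorem mul_card_add_one_le_detNumber_genMycielskian_pendantC4 {t : ℕ} (hn : 1 ≤ n)
    {T : Finset (Fin 4 ⊕ Fin n)} (hT : (pendantC4 n).IsMinTwinCover T) :
    (t + 1) * T.card + 1 ≤ ((pendantC4 n).genMycielskian t).detNumber := by
  classical
  refine le_detNumber fun S hS => ?_
  -- Otherwise `S` consists of copies of the `x_i` and possibly the master, all fixed by the lifted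
  -- reflection.
  obtain ⟨s, a, hsa⟩ : ∃ s a, some (s, Sum.inl a) ∈ S := by
    by_contra! hno
    have h := hS (genMycielskianMap t (pendantC4Reflection n)) (by
      rintro (_ | ⟨s, a | i⟩) hx
      · rfl
      · exact absurd hx (hno s a)
      · rfl)
    have h' : some ((0 : Fin (t + 1)), (Sum.inl (Fin.rev 0) : Fin 4 ⊕ Fin n)) =
        some (0, Sum.inl 0) :=
      congrArg (fun ψ : (pendantC4 n).genMycielskian t ≃g (pendantC4 n).genMycielskian t =>
        ψ (some (0, Sum.inl 0))) h
    simp only [Option.some.injEq, Prod.mk.injEq, Sum.inl.injEq, true_and] at h'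
    exact absurd h' (by decide)
  -- The vertex found is a copy of none of the `x_i`, so without it every level still contains a
  -- twin cover.
  rw [← Finset.card_erase_add_one hsa, Nat.add_le_add_iff_right]
  refine hT.mul_card_le fun r x y h => ?_
  have hxy := hS.isTwinCover.levelFiber r x y h
  obtain ⟨i, j, -, rfl, rfl⟩ := h.exists_inr hn
  simpa [mem_levelFiber] using hxy

end PendantC4

end SimpleGraph

theorem theorem4p6 (t : ℕ) (ht : 1 ≤ t) :
    -- the two bounds
    (∀ (V : Type*) [Finite V] (G : SimpleGraph V) (T : Finset V),
      (∀ x, ¬ G.IsIsolated x) → (∃ x y, G.IsTwin x y) → G.IsMinTwinCover T →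
        (t + 1) * T.card ≤ (G.genMycielskian t).detNumber ∧
        (G.genMycielskian t).detNumber ≤ (t + 1) * T.card + G.twinQuotient.detNumber) ∧
    -- the lower bound is sharp: complete bipartite graphs
    (∀ l m : ℕ, 1 ≤ l → 2 ≤ m →
      (∀ x, ¬ (completeBipartiteGraph (Fin l) (Fin m)).IsIsolated x) ∧
      (∃ x y, (completeBipartiteGraph (Fin l) (Fin m)).IsTwin x y) ∧
      (completeBipartiteGraph (Fin l) (Fin m)).twinQuotient.detNumber = 1 ∧
      ∃ T, (completeBipartiteGraph (Fin l) (Fin m)).IsMinTwinCover T ∧ T.card + 2 = l + m ∧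
        ((completeBipartiteGraph (Fin l) (Fin m)).genMycielskian t).detNumber
          = (t + 1) * T.card) ∧
    -- the upper bound is sharp: the 4-cycle with two pendant vertices and its extensions
    (∀ n : ℕ, 2 ≤ n →
      (∀ x, ¬ (SimpleGraph.pendantC4 n).IsIsolated x) ∧
      (∃ x y, (SimpleGraph.pendantC4 n).IsTwin x y) ∧
      (SimpleGraph.pendantC4 n).twinQuotient.detNumber = 1 ∧
      ∃ T, (SimpleGraph.pendantC4 n).IsMinTwinCover T ∧ T.card + 1 = n ∧
        ((SimpleGraph.pendantC4 n).genMycielskian t).detNumber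
          = (t + 1) * T.card + (SimpleGraph.pendantC4 n).twinQuotient.detNumber) := by
  refine ⟨?_, ?_, ?_⟩
  · rintro V _ G T hG ⟨x, y, hxy⟩ hT
    have hne : T.Nonempty := (hT.1 x y hxy).elim (fun h => ⟨x, h⟩) fun h => ⟨y, h⟩
    exact ⟨SimpleGraph.mul_card_le_detNumber hT, SimpleGraph.genMycielskian_detNumber_le_add ht
      (SimpleGraph.exists_adj_of_not_isIsolated hG) hT.1 hne⟩
  · intro l m hl hm
    have hm' : 1 ≤ m := by omega
    obtain ⟨T, hT, hc⟩ := SimpleGraph.exists_isMinTwinCover_completeBipartiteGraph hl hm'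
    -- `l + m ≥ 3` leaves at least one vertex in `T`, whose copies pin the master.
    have hne : T.Nonempty := Finset.card_pos.1 (by omega)
    refine ⟨fun x hx => ?_, ⟨Sum.inr ⟨0, by omega⟩, Sum.inr ⟨1, by omega⟩, by simp, ?_⟩,
      SimpleGraph.detNumber_twinQuotient_completeBipartiteGraph hl hm', T, hT, hc,
      le_antisymm (SimpleGraph.detNumber_genMycielskian_completeBipartiteGraph_le ht hl hm' hT.1
        hne) (SimpleGraph.mul_card_le_detNumber hT)⟩
    · obtain ⟨y, hy⟩ := SimpleGraph.completeBipartiteGraph_exists_adj hl hm' x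
      exact hx y hy
    · rw [SimpleGraph.completeBipartiteGraph_neighborSet_eq_iff hl hm']
      rfl
  · intro n hn
    have hn' : 1 ≤ n := by omega
    obtain ⟨T, hT, hc⟩ := SimpleGraph.exists_isMinTwinCover_pendantC4 hn'
    have hne : T.Nonempty := Finset.card_pos.1 (by omega)
    have hdet := SimpleGraph.detNumber_twinQuotient_pendantC4 hn'
    refine ⟨fun x hx => ?_, ⟨Sum.inr ⟨0, by omega⟩, Sum.inr ⟨1, by omega⟩, by simp, ?_⟩,
      hdet, T, hT, hc, le_antisymm (SimpleGraph.genMycielskian_detNumber_le_add ht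
        (SimpleGraph.pendantC4_exists_adj hn') hT.1 hne) ?_⟩
    · obtain ⟨y, hy⟩ := SimpleGraph.pendantC4_exists_adj hn' x
      exact hx y hy
    · rw [SimpleGraph.pendantC4_neighborSet_eq_iff hn']
      rfl
    · rw [hdet]
      exact SimpleGraph.mul_card_add_one_le_detNumber_genMycielskian_pendantC4 hn' hT
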